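/- All rings are commutative with 1. A ring $\mathbf{A}$ is called seminormal if whenever $b, c \in \mathbf{A}$ satisfy $b^2 = c^3$, there exists $a \in \mathbf{A}$ with $a^3 = b$ and $a^2 = c$. For a ring $\mathbf{R}$, $\operatorname{Pic} \mathbf{R}$ is the group, under $\otimes$, of isomorphism classes of finitely generated projective $\mathbf{R}$-modules of constant rank $1$ (equivalently, of invertible $\mathbf{R}$-modules). An idempotent matrix $P \in \mathbf{R}^{n \times n}$ is said to be of rank $1$ if its image is a projective module of constant rank $1$, i.e. if $\det(T P + (\mathrm{I}_n - P)) = T$ in the polynomial ring $\mathbf{R}[T]$. We write $\mathrm{I}_{n,1} = \operatorname{Diag}(1, 0, \dots, 0)$ for the standard $n \times n$ projection matrix of rank $1$. **Theorem D.1 (Traverso-Swan-Coquand).** Let $\mathbf{A}$ be a seminormal ring, let $m \ge 0$, and write $\mathbf{A}[\underline{X}] = \mathbf{A}[X_1, \dots, X_m]$. Then the natural homomorphism $\operatorname{Pic} \mathbf{A} \to \operatorname{Pic} \mathbf{A}[\underline{X}]$, $M \mapsto \mathbf{A}[\underline{X}] \otimes_{\mathbf{A}} M$, is an isomorphism. More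 precisely, for every $n$, if $P(\underline{X}) = (m_{i,j}(\underline{X}))_{1 \le i,j \le n}$ is an idempotent matrix of rank $1$ over $\mathbf{A}[\underline{X}]$ with $P(0) = \mathrm{I}_{n,1}$, then there exist polynomials $f_1, \dots, f_n, g_1, \dots, g_n \in \mathbf{A}[\underline{X}]$ such that $m_{i,j} = f_i g_j$ for all $i, j$. -/

import Mathlib

/-- A commutative ring `A` is seminormal if whenever `b ^ 2 = c ^ 3` in `A`, there is `a` in `A`
with `a ^ 3 = b` and `a ^ 2 = c`. -/
def IsSeminormalRing (A : Type*) [CommRing A] : Prop :=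
  ∀ b c : A, b ^ 2 = c ^ 3 → ∃ a : A, a ^ 3 = b ∧ a ^ 2 = c

/-- The rank polynomial of an idempotent matrix `P`: the determinant of the multiplication by `T`
on the extension to `R[T]` of the image of `P`, that is, the determinant of `T • P + (1 - P)`,
which acts as `T` on the image of `P` and as the identity on its kernel. -/
noncomputable def Matrix.rankPolynomial {R : Type*} [CommRing R] {n : ℕ}
    (P : Matrix (Fin n) (Fin n) R) : Polynomial R :=
  ((Polynomial.X : Polynomial R) • P.map Polynomial.C + (1 - P.map Polynomial.C)).det

/-- `P` is an idempotent matrix whose image is a projective module of constant rank `k`: its rank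
polynomial is `T ^ k`. -/
def Matrix.IsIdempotentOfRank {R : Type*} [CommRing R] {n : ℕ}
    (P : Matrix (Fin n) (Fin n) R) (k : ℕ) : Prop :=
  P * P = P ∧ P.rankPolynomial = Polynomial.X ^ k

/-- The standard projection matrix `I_{n,r} = Diag(I_r, 0_{n-r})`. -/
def Matrix.standardProjection (R : Type*) [CommRing R] (n r : ℕ) : Matrix (Fin n) (Fin n) R :=
  Matrix.diagonal fun i => if (i : ℕ) < r then 1 else 0

/-! A seminormal ring `A` is reduced, so it embeds in the product `K` of its residue fields. Over a
field, polynomials form a UFD and a matrix with vanishing `2 × 2` minors is a column times a row;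
degree bounds assemble these factorizations into `P = f g` over `K`. The coefficients of `f` and `g`
are integral over `A` (`isIntegral_coeff_factorization`), hence generate a finite extension `B` of
`A`.

It remains to see that `B = A` (`algebraMap_surjective_of_factorization`). By seminormality the
conductor `c` of `A` in `B` is radical. If `c ≠ B`, localize `B/c` at a prime `p` of `A` minimal
over `c ∩ A`. The result is a reduced algebra over the residue field of `p`, over which `P` also
factors. Factorizations with prescribed constant terms over a reduced ring are unique, so `B` maps
into that residue field. Clearing denominators, some `s ∉ p` satisfies `s B ⊆ A`, that is, `s ∈ c ∩
A ⊆ p`, a contradiction.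

For Picard groups, evaluation at `0` is a retraction, so it suffices that an invertible module
trivial at the origin is free. Such a module is the image of a matrix of the above kind, and a
factorization of that matrix gives a generator. -/

/-! ### Column-times-row factorizations over reduced rings, fields and products of fields -/

open MvPolynomial in
/-- Uniqueness, over a reduced ring, of the factorization of a projection matrix of rank one as
a column times a row with prescribed constant terms. -/
theorem MvPolynomial.factorization_unique {D σ ι : Type*} [CommRing D] [IsReduced D] [Fintype ι]
    {f g f' g' : ι → MvPolynomial σ D} {v : ι → D}
    (h : ∀ i j, f i * g j = f' i * g' j) (htr : ∑ i, f i * g i = 1)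
    (hf : ∀ i, constantCoeff (f i) = constantCoeff (f' i))
    (hv : ∑ i, v i * constantCoeff (f i) = 1) :
    f = f' ∧ g = g' := by
  have htr' : ∑ i, f' i * g' i = 1 := by simpa only [h] using htr
  set w : MvPolynomial σ D := ∑ i, f' i * g i
  have hwf (j) : w * f j = f' j := by
    calc w * f j = ∑ i, f' i * (f j * g i) := by
          rw [Finset.sum_mul]; exact Finset.sum_congr rfl fun i _ ↦ by ring
      _ = (∑ i, f' i * g' i) * f' j := by
          rw [Finset.sum_mul]; exact Finset.sum_congr rfl fun i _ ↦ by rw [h]; ring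
      _ = f' j := by rw [htr', one_mul]
  have hwg (j) : w * g' j = g j := by
    calc w * g' j = ∑ i, g i * (f' i * g' j) := by
          rw [Finset.sum_mul]; exact Finset.sum_congr rfl fun i _ ↦ by ring
      _ = (∑ i, f i * g i) * g j := by
          rw [Finset.sum_mul]; exact Finset.sum_congr rfl fun i _ ↦ by rw [← h]; ring
      _ = g j := by rw [htr, one_mul]
  have hunit : w * ∑ i, f i * g' i = 1 := by
    rw [Finset.mul_sum, ← htr']
    exact Finset.sum_congr rfl fun i _ ↦ by rw [← mul_assoc, hwf]
  -- Over a reduced ring the units of the polynomial ring are constants.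
  obtain ⟨r, -, hr⟩ := isUnit_iff_eq_C_of_isReduced.mp (IsUnit.of_mul_eq_one _ hunit)
  have hr1 : r = 1 := by
    have hrf (i) : r * constantCoeff (f i) = constantCoeff (f i) := by
      conv_rhs => rw [hf, ← hwf, map_mul, hr, constantCoeff_C]
    rw [← mul_one r, ← hv, Finset.mul_sum]
    exact Finset.sum_congr rfl fun i _ ↦ by rw [mul_left_comm, hrf]
  have hw : w = 1 := by rw [hr, hr1, map_one]
  simp only [hw, one_mul] at hwf hwg
  exact ⟨_root_.funext hwf, (_root_.funext hwg).symm⟩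

/-- Over a unique factorization domain, a nonzero matrix with vanishing `2 × 2` minors is the
product of a column and a row. -/
theorem exists_factorization_of_minors_eq_zero {R ι : Type*} [CommRing R] [IsDomain R]
    [UniqueFactorizationMonoid R] [Fintype ι] {P : ι → ι → R}
    (hP : ∀ i j k l, P i j * P k l = P i l * P k j) (hne : ∃ i j, P i j ≠ 0) :
    ∃ f g : ι → R, ∀ i j, P i j = f i * g j := by
  classical
  obtain ⟨i₀, j₀, h₀⟩ := hne
  obtain ⟨_⟩ : Nonempty (NormalizedGCDMonoid R) := inferInstance
  -- The column of `f` is a nonzero column of `P` divided by its gcd; being primitive, it makes the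
  -- row `g` integral.
  obtain ⟨f, hf, hgcd⟩ := Finset.univ.extract_gcd (fun i ↦ P i j₀) ⟨i₀, Finset.mem_univ _⟩
  set d := Finset.univ.gcd fun i ↦ P i j₀
  have hf (i) : P i j₀ = d * f i := hf i (Finset.mem_univ _)
  have hd : d ≠ 0 := by rintro h; exact h₀ (by rw [hf, h, zero_mul])
  have hf₀ : f i₀ ≠ 0 := by rintro h; exact h₀ (by rw [hf, h, mul_zero])
  have key (i j) : f i * P i₀ j = f i₀ * P i j := by
    apply mul_left_cancel₀ hd
    linear_combination -(P i₀ j) * hf i + P i j * hf i₀ + hP i j₀ i₀ j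
  have hdvd (j) : f i₀ ∣ P i₀ j := by
    have : f i₀ ∣ Finset.univ.gcd fun i ↦ f i * P i₀ j :=
      Finset.dvd_gcd fun i _ ↦ ⟨P i j, key i j⟩
    have h1 := this.trans (Finset.gcd_mul_right' ..).dvd
    rwa [hgcd, one_mul] at h1
  choose g hg using hdvd
  refine ⟨f, g, fun i j ↦ mul_left_cancel₀ hf₀ ?_⟩
  rw [← key, hg]
  ring

open MvPolynomial in
/-- Over a field, a matrix of polynomials with vanishing `2 × 2` minors whose constant term is the
product of the column `u` and the row `v`, with `v u = 1`, is the product of a column and a row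
with constant terms `u` and `v`. -/
theorem MvPolynomial.exists_factorization_of_field {k σ ι : Type*} [Field k] [Fintype ι]
    {P : ι → ι → MvPolynomial σ k} {u v : ι → k}
    (hP : ∀ i j k l, P i j * P k l = P i l * P k j)
    (h0 : ∀ i j, constantCoeff (P i j) = u i * v j) (huv : ∑ i, v i * u i = 1) :
    ∃ f g : ι → MvPolynomial σ k, (∀ i j, P i j = f i * g j) ∧
      (∀ i, constantCoeff (f i) = u i) ∧ ∀ i, constantCoeff (g i) = v i := by
  obtain ⟨f, g, h⟩ := exists_factorization_of_minors_eq_zero hP (by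
    by_contra! hz
    have hz (i) : v i * u i = 0 := by rw [mul_comm, ← h0, hz, map_zero]
    simp [hz] at huv)
  have h (i j) : P i j = f i * g j := h i j
  have hc (i j) : constantCoeff (f i) * constantCoeff (g j) = u i * v j := by
    rw [← map_mul, ← h, h0]
  -- These scalars are mutually inverse, and rescaling `f` by `b` and `g` by `a` corrects the
  -- constant terms.
  set a := ∑ i, v i * constantCoeff (f i)
  set b := ∑ i, constantCoeff (g i) * u i
  have hau (i) : constantCoeff (f i) * b = u i := by
    calc _ = ∑ j, u i * (v j * u j) := by
          rw [Finset.mul_sum]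
          exact Finset.sum_congr rfl fun j _ ↦ by rw [← mul_assoc, hc, mul_assoc]
      _ = u i := by rw [← Finset.mul_sum, huv, mul_one]
  have hbv (i) : constantCoeff (g i) * a = v i := by
    calc _ = ∑ j, v i * (v j * u j) := by
          rw [Finset.mul_sum]
          exact Finset.sum_congr rfl fun j _ ↦ by
            rw [mul_left_comm, mul_comm _ (constantCoeff (f j)), hc]; ring
      _ = v i := by rw [← Finset.mul_sum, huv, mul_one]
  have hab : a * b = 1 := by
    rw [← huv, Finset.sum_mul]
    exact Finset.sum_congr rfl fun i _ ↦ by rw [mul_assoc, hau]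
  refine ⟨fun i ↦ f i * C b, fun j ↦ g j * C a, fun i j ↦ ?_, fun i ↦ ?_, fun i ↦ ?_⟩
  · have : (C a * C b : MvPolynomial σ k) = 1 := by rw [← map_mul, hab, map_one]
    rw [h]; linear_combination -(f i * g j) * this
  · simp [hau]
  · simp [hbv]

open MvPolynomial in
/-- A family of polynomials with bounded total degrees over the factors of a product of rings
comes from a polynomial over the product. -/
theorem MvPolynomial.exists_map_evalRingHom_eq {σ I : Type*} [Finite σ] {k : I → Type*}
    [∀ p, CommRing (k p)] (F : ∀ p, MvPolynomial σ (k p)) {N : ℕ}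
    (hN : ∀ p, (F p).totalDegree ≤ N) :
    ∃ f : MvPolynomial σ (∀ p, k p), ∀ p, map (Pi.evalRingHom k p) f = F p := by
  classical
  refine ⟨∑ d ∈ Finset.Iic (Finsupp.equivFunOnFinite.symm fun _ ↦ N),
    monomial d fun p ↦ coeff d (F p), fun p ↦ ?_⟩
  ext e
  simp only [map_sum, map_monomial, Pi.evalRingHom_apply, coeff_sum, coeff_monomial]
  rw [Finset.sum_ite_eq', ite_eq_left_iff]
  intro he
  by_contra h
  refine he (Finset.mem_Iic.mpr fun i ↦ ?_)
  refine (Finsupp.le_degree i e).trans (le_trans ?_ (hN p))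
  exact le_totalDegree (mem_support_iff.mpr (Ne.symm h))

open MvPolynomial in
/-- Over a product of fields, a matrix of polynomials of the shape considered in
`MvPolynomial.exists_factorization_of_field` has a factorization of the same kind. -/
theorem MvPolynomial.exists_factorization_of_pi {I σ ι : Type*} [Finite σ] [Fintype ι]
    {k : I → Type*} [∀ p, Field (k p)] {P : ι → ι → MvPolynomial σ (∀ p, k p)}
    {u v : ι → ∀ p, k p} (hP : ∀ i j k l, P i j * P k l = P i l * P k j)
    (h0 : ∀ i j, constantCoeff (P i j) = u i * v j) (huv : ∑ i, v i * u i = 1) :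
    ∃ f g : ι → MvPolynomial σ (∀ p, k p), (∀ i j, P i j = f i * g j) ∧
      (∀ i, constantCoeff (f i) = u i) ∧ ∀ i, constantCoeff (g i) = v i := by
  have hloc (p : I) := exists_factorization_of_field
    (P := fun i j ↦ map (Pi.evalRingHom k p) (P i j)) (u := fun i ↦ u i p) (v := fun i ↦ v i p)
    (fun i j k l ↦ by rw [← map_mul, hP, map_mul])
    (fun i j ↦ by rw [constantCoeff_map, h0]; rfl)
    (by simpa using congr_fun huv p)
  choose F G hFG hF hG using hloc
  set N := ∑ i, ∑ j, (P i j).totalDegree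
  have hN (p i j) : (map (Pi.evalRingHom k p) (P i j)).totalDegree ≤ N := by
    refine (Finset.sup_mono (support_map_subset _ _)).trans ?_
    refine le_trans ?_ (Finset.single_le_sum (fun _ _ ↦ Nat.zero_le _) (Finset.mem_univ i))
    exact Finset.single_le_sum (f := fun j ↦ (P i j).totalDegree) (fun _ _ ↦ Nat.zero_le _)
      (Finset.mem_univ j)
  have hFne (p) : ∃ i, F p i ≠ 0 := by
    by_contra! hz
    have hz (i) : u i p = 0 := by rw [← hF, hz, map_zero]
    simpa [hz] using congr_fun huv p
  have hGne (p) : ∃ i, G p i ≠ 0 := by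
    by_contra! hz
    have hz (i) : v i p = 0 := by rw [← hG, hz, map_zero]
    simpa [hz] using congr_fun huv p
  -- Total degrees add over a domain, so a nonzero entry of `G p` bounds `F p i` by an entry of `P`,
  -- uniformly in `p`.
  have hFN (i p) : (F p i).totalDegree ≤ N := by
    by_cases h : F p i = 0
    · simp [h]
    obtain ⟨j, hj⟩ := hGne p
    refine le_trans ?_ (hN p i j)
    rw [hFG, totalDegree_mul_of_isDomain h hj]
    exact Nat.le_add_right _ _
  have hGN (j p) : (G p j).totalDegree ≤ N := by
    by_cases h : G p j = 0
    · simp [h]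
    obtain ⟨i, hi⟩ := hFne p
    refine le_trans ?_ (hN p i j)
    rw [hFG, totalDegree_mul_of_isDomain hi h]
    exact Nat.le_add_left _ _
  choose f hf using fun i ↦ exists_map_evalRingHom_eq (fun p ↦ F p i) (hFN i)
  choose g hg using fun i ↦ exists_map_evalRingHom_eq (fun p ↦ G p i) (hGN i)
  refine ⟨f, g, fun i j ↦ ?_, fun i ↦ ?_, fun i ↦ ?_⟩
  · ext d p
    have := congr_arg (coeff d) (hFG p i j)
    rwa [← hf, ← hg, ← map_mul, coeff_map, coeff_map] at this
  · funext p
    rw [← hF, ← hf, constantCoeff_map]; rfl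
  · funext p
    rw [← hG, ← hg, constantCoeff_map]; rfl

/-! ### Integrality of the coefficients -/

open MvPolynomial in
/-- The substitution `Xᵢ ↦ Xᵢ T`, which grades polynomials by their total degree. -/
noncomputable def MvPolynomial.homogenization (σ R : Type*) [CommRing R] :
    MvPolynomial σ R →+* Polynomial (MvPolynomial σ R) :=
  eval₂Hom (Polynomial.C.comp C) fun i ↦ Polynomial.C (X i) * Polynomial.X

open MvPolynomial in
theorem MvPolynomial.eval_one_homogenization {σ R : Type*} [CommRing R] (f : MvPolynomial σ R) :
    (homogenization σ R f).eval 1 = f := by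
  change ((Polynomial.evalRingHom 1).comp (homogenization σ R)) f = RingHom.id _ f
  congr 1
  ext <;> simp [homogenization]

open MvPolynomial in
theorem MvPolynomial.coeff_zero_homogenization {σ R : Type*} [CommRing R] (f : MvPolynomial σ R) :
    (homogenization σ R f).coeff 0 = C (constantCoeff f) := by
  change (Polynomial.constantCoeff.comp (homogenization σ R)) f = (C.comp constantCoeff) f
  congr 1
  ext <;> simp [homogenization]

open MvPolynomial in
theorem MvPolynomial.homogenization_map {σ R S : Type*} [CommRing R] [CommRing S] (φ : R →+* S)
    (f : MvPolynomial σ R) :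
    homogenization σ S (map φ f) = (homogenization σ R f).map (map φ) := by
  change ((homogenization σ S).comp (map φ)) f =
    ((Polynomial.mapRingHom (map φ)).comp (homogenization σ R)) f
  congr 1
  ext <;> simp [homogenization]

/-- Turns constant term `1` into leading coefficient `1`, so that results on factors of monic
polynomials apply. -/
theorem Polynomial.monic_reflect {R : Type*} [CommRing R] (p : Polynomial R) {n : ℕ}
    (hp : p.natDegree ≤ n) (hp0 : p.coeff 0 = 1) : (p.reflect n).Monic := by
  refine monic_of_natDegree_le_of_coeff_eq_one n ?_ ?_
  · exact natDegree_reflect_le.trans (by simp [hp])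
  · rw [coeff_reflect, revAt_le le_rfl, Nat.sub_self, hp0]

attribute [local instance] MvPolynomial.algebraMvPolynomial in
open MvPolynomial in
/-- If the product of two polynomials with constant term `1` has coefficients in `A`, the
coefficients of the factors are integral over `A`. -/
theorem MvPolynomial.isIntegral_coeff_of_mul_eq_map {σ A K : Type*} [CommRing A] [CommRing K]
    [Algebra A K] (hinj : Function.Injective (algebraMap A K)) {h k : MvPolynomial σ K}
    {q : MvPolynomial σ A} (hk : h * k = map (algebraMap A K) q)
    (hh0 : constantCoeff h = 1) (hk0 : constantCoeff k = 1) (d : σ →₀ ℕ) :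
    IsIntegral A (h.coeff d) := by
  nontriviality K
  set H := homogenization σ K h
  set G := homogenization σ K k
  set Q := homogenization σ A q
  have hq0 : constantCoeff q = 1 := hinj (by
    rw [← constantCoeff_map, ← hk, map_mul, hh0, hk0, map_one, mul_one])
  have hmul : H * G = Q.map (algebraMap (MvPolynomial σ A) (MvPolynomial σ K)) := by
    rw [algebraMap_def, ← homogenization_map, ← hk, map_mul]
  have hH0 : H.coeff 0 = 1 := by rw [coeff_zero_homogenization, hh0, map_one]
  have hQ0 : Q.coeff 0 = 1 := by rw [coeff_zero_homogenization, hq0, map_one]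
  set N := H.natDegree + G.natDegree
  have hQN : Q.natDegree ≤ N := by
    rw [← Polynomial.natDegree_map_eq_of_injective
      (f := algebraMap (MvPolynomial σ A) (MvPolynomial σ K))
      (by rw [algebraMap_def]; exact map_injective _ hinj) Q, ← hmul]
    exact Polynomial.natDegree_mul_le
  -- A monic factor of a monic polynomial over `A[X]` has coefficients integral over `A[X]`.
  have hdvd : H.reflect H.natDegree ∣
      (Q.reflect N).map (algebraMap (MvPolynomial σ A) (MvPolynomial σ K)) := by
    rw [← Polynomial.reflect_map, ← hmul, Polynomial.reflect_mul _ _ le_rfl le_rfl]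
    exact dvd_mul_right _ _
  have hint (i) : IsIntegral (MvPolynomial σ A) (H.coeff i) := by
    have := Polynomial.isIntegral_coeff_of_dvd _ _ (Q.monic_reflect hQN hQ0)
      (H.monic_reflect le_rfl hH0) hdvd (Polynomial.revAt H.natDegree i)
    rwa [Polynomial.coeff_reflect, Polynomial.revAt_invol] at this
  refine isIntegral_iff_isIntegral_coeff.mp ?_ d
  rw [← eval_one_homogenization h, Polynomial.eval_eq_sum_range]
  exact IsIntegral.sum _ fun i _ ↦ by simpa using hint i

open MvPolynomial in
/-- If `P = f g` is a column times a row over an extension of `A`, with `P` over `A` and constant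
terms `u`, `v` over `A` such that `v u = 1`, then the coefficients of `f` are integral over `A`. -/
theorem MvPolynomial.isIntegral_coeff_factorization {σ ι A K : Type*} [CommRing A] [CommRing K]
    [Algebra A K] [Fintype ι] (hinj : Function.Injective (algebraMap A K))
    {P : ι → ι → MvPolynomial σ A} {f g : ι → MvPolynomial σ K} {u v : ι → A}
    (h : ∀ i j, map (algebraMap A K) (P i j) = f i * g j)
    (hf : ∀ i, constantCoeff (f i) = algebraMap A K (u i))
    (hg : ∀ i, constantCoeff (g i) = algebraMap A K (v i))
    (huv : ∑ i, v i * u i = 1) (i : ι) (d : σ →₀ ℕ) : IsIntegral A ((f i).coeff d) := by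
  have hvu : ∑ i, algebraMap A K (v i) * algebraMap A K (u i) = 1 := by
    simpa using congr_arg (algebraMap A K) huv
  set r : MvPolynomial σ K := ∑ j, f j * C (algebraMap A K (v j)) with hr
  set s : MvPolynomial σ K := ∑ j, g j * C (algebraMap A K (u j)) with hs
  have hr0 : constantCoeff r = 1 := by
    rw [← hvu, hr, map_sum]
    exact Finset.sum_congr rfl fun j _ ↦ by rw [map_mul, hf, constantCoeff_C, mul_comm]
  have hs0 : constantCoeff s = 1 := by
    rw [← hvu, hs, map_sum]
    exact Finset.sum_congr rfl fun j _ ↦ by rw [map_mul, hg, constantCoeff_C]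
  have hfs (j) : f j * s = map (algebraMap A K) (∑ l, P j l * C (u l)) := by
    rw [hs, Finset.mul_sum, map_sum]
    exact Finset.sum_congr rfl fun l _ ↦ by rw [map_mul, h, map_C, mul_assoc]
  have hrs : r * s = map (algebraMap A K) (∑ j, (∑ l, P j l * C (u l)) * C (v j)) := by
    rw [hr, Finset.sum_mul, map_sum]
    exact Finset.sum_congr rfl fun l _ ↦ by rw [map_mul, ← hfs, map_C]; ring
  have hint := isIntegral_coeff_of_mul_eq_map hinj hrs hr0 hs0 d
  -- The entry `f i` has constant term `u i`; adding `(1 - u i) r` makes it `1` and keeps the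
  -- product with `s` over `A`.
  have hint' : IsIntegral A ((f i + C (algebraMap A K (1 - u i)) * r).coeff d) := by
    refine isIntegral_coeff_of_mul_eq_map hinj (k := s)
      (q := ∑ l, P i l * C (u l) + C (1 - u i) * ∑ j, (∑ l, P j l * C (u l)) * C (v j)) ?_ ?_ hs0 d
    · rw [add_mul, mul_assoc, hfs, hrs, map_add, map_mul, map_C]
    · rw [map_add, map_mul, hr0, hf, constantCoeff_C, map_sub, map_one]; ring
  have := hint'.sub ((isIntegral_algebraMap (A := K) (x := 1 - u i)).mul hint)
  rwa [coeff_add, coeff_C_mul, add_sub_cancel_right] at this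

/-! ### The conductor argument -/

/-- The conductor of a ring extension, as an ideal of the upper ring. -/
def conductorIdeal (A B : Type*) [CommRing A] [CommRing B] [Algebra A B] : Ideal B where
  carrier := {x | ∀ b, x * b ∈ (algebraMap A B).range}
  zero_mem' b := by simp
  add_mem' hx hy b := by rw [add_mul]; exact add_mem (hx b) (hy b)
  smul_mem' c x hx b := by rw [smul_eq_mul, mul_comm c, mul_assoc]; exact hx _

/-- The conductor of an extension in which `A` contains every element whose square and cube
are in `A` is a radical ideal. -/
theorem conductorIdeal_isRadical {A B : Type*} [CommRing A] [CommRing B] [Algebra A B]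
    (hsn : ∀ x : B, x ^ 2 ∈ (algebraMap A B).range → x ^ 3 ∈ (algebraMap A B).range →
      x ∈ (algebraMap A B).range) : (conductorIdeal A B).IsRadical := by
  rw [Ideal.isRadical_iff_quotient_reduced, isReduced_iff_pow_one_lt 2 one_lt_two]
  rintro ⟨x⟩ hx
  have hx : x ^ 2 ∈ conductorIdeal A B := Ideal.Quotient.eq_zero_iff_mem.mp hx
  refine Ideal.Quotient.eq_zero_iff_mem.mpr fun b ↦ ?_
  -- Both `(x b)² = x² b²` and `(x b)³ = x² (x b³)` lie in `A`, since `x²` is in the conductor.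
  refine hsn _ ?_ ?_
  · rw [mul_pow]; exact hx _
  · have := hx (x * b ^ 3)
    rwa [show x ^ 2 * (x * b ^ 3) = (x * b) ^ 3 by ring] at this

open MvPolynomial in
/-- Let `B` be a finite extension of `A`, generated by the coefficients of `f` and `g`, such that
`A` contains every element of `B` whose square and cube are in `A`. If the matrix `f g` has trace
`1` and comes from a matrix over `A` that factors over every residue field of `A`, then `B = A`. -/
theorem MvPolynomial.algebraMap_surjective_of_factorization {A B σ ι : Type*} [CommRing A]
    [CommRing B] [Algebra A B] [Module.Finite A B] [Fintype ι]
    (hsn : ∀ x : B, x ^ 2 ∈ (algebraMap A B).range → x ^ 3 ∈ (algebraMap A B).range →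
      x ∈ (algebraMap A B).range)
    {P : ι → ι → MvPolynomial σ A} {u v : ι → A}
    (hP : ∀ i j k l, P i j * P k l = P i l * P k j)
    (h0 : ∀ i j, constantCoeff (P i j) = u i * v j) (huv : ∑ i, v i * u i = 1)
    (htr : ∑ i, P i i = 1)
    {f g : ι → MvPolynomial σ B} (h : ∀ i j, map (algebraMap A B) (P i j) = f i * g j)
    (hf : ∀ i, constantCoeff (f i) = algebraMap A B (u i))
    (hgen : Algebra.adjoin A
      {b | ∃ i d, b = (f i).coeff d ∨ b = (g i).coeff d} = ⊤) :
    Function.Surjective (algebraMap A B) := by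
  classical
  set c := conductorIdeal A B
  have hrad := conductorIdeal_isRadical hsn
  suffices hc : c.comap (algebraMap A B) = ⊤ by
    have h1 : (1 : A) ∈ c.comap (algebraMap A B) := hc ▸ Submodule.mem_top
    intro b
    simpa using h1 b
  by_contra hc
  obtain ⟨m, hm, hcm⟩ := Ideal.exists_le_maximal _ hc
  have := hm.isPrime
  obtain ⟨p, hp, -⟩ := Ideal.exists_minimalPrimes_le hcm
  have := hp.1.1
  have : IsReduced (B ⧸ c) := (Ideal.isRadical_iff_quotient_reduced _).mp hrad
  let M := Algebra.algebraMapSubmonoid (B ⧸ c) p.primeCompl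
  let D := Localization M
  let π : B →+* D := (algebraMap (B ⧸ c) D).comp (Ideal.Quotient.mk c)
  let ψ : A →+* D := π.comp (algebraMap A B)
  have hunit (s : A) (hs : s ∉ p) : IsUnit (ψ s) :=
    IsLocalization.map_units D (⟨_, s, hs, rfl⟩ : M)
  have hker : p ≤ RingHom.ker ψ := by
    intro x hx
    rw [RingHom.mem_ker]
    refine IsNilpotent.eq_zero (nilpotent_iff_mem_prime.mpr fun Q hQ ↦ ?_)
    -- By minimality of `p`, every prime of `D` lies over `p`; thus `p` maps into the nilradical of
    -- `D`, which is zero.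
    have hQp : Q.comap ψ ≤ p := by
      intro y hy
      by_contra hyp
      exact hQ.ne_top (Ideal.eq_top_of_isUnit_mem _ hy (hunit y hyp))
    refine hp.2 ⟨Ideal.IsPrime.comap ψ, fun y hy ↦ ?_⟩ hQp hx
    have : ψ y = 0 := by
      change algebraMap (B ⧸ c) D (Ideal.Quotient.mk c (algebraMap A B y)) = 0
      rw [Ideal.Quotient.eq_zero_iff_mem.mpr (Ideal.mem_comap.mp hy), map_zero]
    simp [Ideal.mem_comap, this]
  let θ : p.ResidueField →+* D := Ideal.ResidueField.lift p ψ hker hunit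
  have hθ (a : A) : θ (algebraMap A _ a) = ψ a := 
    Ideal.ResidueField.lift_algebraMap p ψ hker hunit a
  have hθc : θ.comp (algebraMap A p.ResidueField) = ψ := RingHom.ext hθ
  obtain ⟨f', g', h', hf', hg'⟩ := exists_factorization_of_field
    (P := fun i j ↦ map (algebraMap A p.ResidueField) (P i j))
    (u := fun i ↦ algebraMap A p.ResidueField (u i))
    (v := fun i ↦ algebraMap A p.ResidueField (v i))
    (fun i j k l ↦ by rw [← map_mul, hP, map_mul])
    (fun i j ↦ by rw [constantCoeff_map, h0, map_mul])
    (by simpa using congr_arg (algebraMap A p.ResidueField) huv)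
  have hfac (i j) : map π (f i) * map π (g j) = map θ (f' i) * map θ (g' j) := by
    rw [← map_mul, ← map_mul, ← h, ← h', map_map, map_map, hθc]
  obtain ⟨hff, hgg⟩ := factorization_unique (f := fun i ↦ map π (f i)) (g := fun i ↦ map π (g i))
    (f' := fun i ↦ map θ (f' i)) (g' := fun i ↦ map θ (g' i)) (v := fun i ↦ ψ (v i)) hfac
    (by
      simp_rw [← map_mul, ← h, ← map_sum, htr, map_one])
    (fun i ↦ by rw [constantCoeff_map, constantCoeff_map, hf, hf', hθ]; rfl)
    (by
      simp_rw [constantCoeff_map, hf]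
      change ∑ i, ψ (v i) * ψ (u i) = 1
      simpa using congr_arg ψ huv)
  have hrange (b : B) : π b ∈ θ.range := by
    let T : Subalgebra A B :=
      { θ.range.comap π with
        algebraMap_mem' := fun a ↦ ⟨algebraMap A _ a, hθ a⟩ }
    have : (⊤ : Subalgebra A B) ≤ T := by
      rw [← hgen, Algebra.adjoin_le_iff]
      rintro _ ⟨i, d, rfl | rfl⟩
      · refine ⟨(f' i).coeff d, ?_⟩
        rw [← coeff_map, ← coeff_map, ← congr_fun hff i]
      · refine ⟨(g' i).coeff d, ?_⟩
        rw [← coeff_map, ← coeff_map, ← congr_fun hgg i]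
    exact this Algebra.mem_top
  have hden (b : B) : ∃ s ∉ p, algebraMap A B s * b ∈ (algebraMap A B).range := by
    obtain ⟨y, hy⟩ := hrange b
    obtain ⟨x, z, hz, rfl⟩ := IsFractionRing.div_surjective (A := A ⧸ p) y
    obtain ⟨a, rfl⟩ := Ideal.Quotient.mk_surjective x
    obtain ⟨s, rfl⟩ := Ideal.Quotient.mk_surjective z
    have hs : s ∉ p := fun hs ↦
      nonZeroDivisors.ne_zero hz (Ideal.Quotient.eq_zero_iff_mem.mpr hs)
    change θ (algebraMap A _ a / algebraMap A _ s) = π b at hy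
    have hs0 : algebraMap A p.ResidueField s ≠ 0 := by
      rwa [Ne, ← RingHom.mem_ker, Ideal.ker_algebraMap_residueField]
    have hab : π (algebraMap A B s * b - algebraMap A B a) = 0 := by
      rw [map_sub, map_mul, ← hy]
      change ψ s * _ - ψ a = 0
      rw [← hθ, ← hθ, ← map_mul, mul_div_cancel₀ _ hs0, sub_self]
    obtain ⟨⟨_, t, ht, rfl⟩, hm⟩ := (IsLocalization.map_eq_zero_iff M D _).mp hab
    have hm : Ideal.Quotient.mk c (algebraMap A B t * (algebraMap A B s * b - algebraMap A B a)) =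
      0 := by rw [map_mul]; exact hm
    -- An element of the conductor, multiplied by `1`, lies in the image of `A`.
    obtain ⟨e, he⟩ := Ideal.Quotient.eq_zero_iff_mem.mp hm 1
    refine ⟨t * s, p.primeCompl.mul_mem ht hs, e + t * a, ?_⟩
    rw [map_add, map_mul, map_mul, he]
    ring
  obtain ⟨S, hS⟩ := Module.finite_def.mp ‹Module.Finite A B›
  choose s hsp hs using hden
  -- A common denominator for finitely many generators of `B` lies in the conductor.
  have hprod : ∏ b ∈ S, s b ∉ p := by
    rw [Ideal.IsPrime.prod_mem_iff]; simpa using fun b _ ↦ hsp b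
  refine hprod (hp.1.2 fun b ↦ ?_)
  have hb : b ∈ Submodule.span A (S : Set B) := hS ▸ Submodule.mem_top
  induction hb using Submodule.span_induction with
  | zero => simp
  | add x y _ _ hx hy => rw [mul_add]; exact add_mem hx hy
  | smul a x _ hx =>
    rw [Algebra.smul_def, mul_left_comm]; exact mul_mem ⟨a, rfl⟩ hx
  | mem x hx =>
    rw [← Finset.prod_erase_mul _ _ (Finset.mem_coe.mp hx), map_mul, mul_assoc]
    exact mul_mem ⟨_, rfl⟩ (hs x)

/-! ### Seminormal rings and descent of the factorization -/

theorem IsSeminormalRing.isReduced {A : Type*} [CommRing A] (hA : IsSeminormalRing A) :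
    IsReduced A := by
  rw [isReduced_iff_pow_one_lt 2 one_lt_two]
  intro x hx
  obtain ⟨a, rfl, ha⟩ := hA x 0 (by rw [hx, zero_pow three_ne_zero])
  rw [pow_succ, ha, zero_mul]

/-- A seminormal ring contains every element of a reduced extension whose square and cube it
contains. -/
theorem IsSeminormalRing.mem_range_algebraMap {A B : Type*} [CommRing A] (hA : IsSeminormalRing A)
    [CommRing B] [IsReduced B] [Algebra A B] (hinj : Function.Injective (algebraMap A B)) {x : B}
    (h2 : x ^ 2 ∈ (algebraMap A B).range) (h3 : x ^ 3 ∈ (algebraMap A B).range) :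
    x ∈ (algebraMap A B).range := by
  obtain ⟨c, hc⟩ := h2
  obtain ⟨b, hb⟩ := h3
  obtain ⟨a, rfl, rfl⟩ := hA b c (hinj (by rw [map_pow, map_pow, hb, hc]; ring))
  rw [map_pow] at hb hc
  -- Two elements with equal squares and equal cubes have a difference of cube zero.
  refine ⟨a, sub_eq_zero.mp (pow_eq_zero_iff three_ne_zero |>.mp ?_)⟩
  linear_combination 4 * hb - 3 * (x + algebraMap A B a) * hc

theorem PrimeSpectrum.injective_algebraMap_residueField (R : Type*) [CommRing R] [IsReduced R] :
    Function.Injective (algebraMap R (∀ p : PrimeSpectrum R, p.asIdeal.ResidueField)) := by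
  rw [injective_iff_map_eq_zero]
  intro x hx
  refine IsNilpotent.eq_zero (nilpotent_iff_mem_prime.mpr fun p hp ↦ ?_)
  rw [← Ideal.ker_algebraMap_residueField p]
  exact congr_fun hx ⟨p, hp⟩

theorem MvPolynomial.finite_setOf_eq_coeff {R σ ι : Type*} [CommSemiring R] [Finite ι]
    (f : ι → MvPolynomial σ R) : {b | ∃ i d, b = (f i).coeff d}.Finite := by
  refine (Set.finite_iUnion fun i ↦ ((f i).coeffs.finite_toSet.insert 0)).subset ?_
  rintro _ ⟨i, d, rfl⟩
  refine Set.mem_iUnion.mpr ⟨i, ?_⟩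
  by_cases h : (f i).coeff d = 0
  · exact Or.inl h
  · exact Or.inr (coeff_mem_coeffs d h)

open MvPolynomial in
/-- Over a seminormal ring, a matrix of polynomials with vanishing `2 × 2` minors and trace `1`
whose constant term is the product of a column and a row is the product of a column and a row. -/
theorem IsSeminormalRing.exists_factorization {A σ ι : Type*} [CommRing A]
    (hA : IsSeminormalRing A) [Finite σ] [Fintype ι] {P : ι → ι → MvPolynomial σ A} {u v : ι → A}
    (hP : ∀ i j k l, P i j * P k l = P i l * P k j)
    (h0 : ∀ i j, constantCoeff (P i j) = u i * v j) (huv : ∑ i, v i * u i = 1)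
    (htr : ∑ i, P i i = 1) :
    ∃ f g : ι → MvPolynomial σ A, ∀ i j, P i j = f i * g j := by
  have := hA.isReduced
  let K := ∀ p : PrimeSpectrum A, p.asIdeal.ResidueField
  have hinj : Function.Injective (algebraMap A K) :=
    PrimeSpectrum.injective_algebraMap_residueField A
  obtain ⟨f, g, hfg, hf, hg⟩ := exists_factorization_of_pi
    (k := fun p : PrimeSpectrum A ↦ p.asIdeal.ResidueField)
    (P := fun i j ↦ map (algebraMap A K) (P i j))
    (u := fun i ↦ algebraMap A K (u i)) (v := fun i ↦ algebraMap A K (v i))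
    (fun i j k l ↦ by rw [← map_mul, hP, map_mul])
    (fun i j ↦ by rw [constantCoeff_map, h0, map_mul])
    (by simpa using congr_arg (algebraMap A K) huv)
  let S : Set K := {b | ∃ i d, b = (f i).coeff d ∨ b = (g i).coeff d}
  have hSfin : S.Finite := by
    refine ((finite_setOf_eq_coeff f).union (finite_setOf_eq_coeff g)).subset ?_
    rintro b ⟨i, d, h | h⟩
    exacts [Or.inl ⟨i, d, h⟩, Or.inr ⟨i, d, h⟩]
  have hSint : ∀ b ∈ S, IsIntegral A b := by
    rintro _ ⟨i, d, rfl | rfl⟩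
    · exact isIntegral_coeff_factorization hinj hfg hf hg huv i d
    -- Transposing `P` exchanges the roles of `f` and `g`.
    · exact isIntegral_coeff_factorization (P := fun i j ↦ P j i) hinj
        (fun i j ↦ by rw [hfg, mul_comm]) hg hf (by simpa only [mul_comm] using huv) i d
  let B := Algebra.adjoin A S
  have : Module.Finite A B := Module.Finite.iff_fg.mpr (fg_adjoin_of_finite hSfin hSint)
  have hlift (q : MvPolynomial σ K) (hq : ∀ d, q.coeff d ∈ S) :
      ∃ q' : MvPolynomial σ B, map (algebraMap B K) q' = q := by
    refine mem_range_map_iff_coeffs_subset.mpr fun b hb ↦ ?_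
    obtain ⟨d, -, rfl⟩ := mem_coeffs_iff.mp hb
    exact ⟨⟨_, Algebra.subset_adjoin (hq d)⟩, rfl⟩
  choose f' hf' using fun i ↦ hlift (f i) fun d ↦ ⟨i, d, Or.inl rfl⟩
  choose g' hg' using fun i ↦ hlift (g i) fun d ↦ ⟨i, d, Or.inr rfl⟩
  have hBK : Function.Injective (algebraMap B K) := Subtype.val_injective
  have hAB : Function.Injective (algebraMap A B) := .of_comp (f := algebraMap B K) hinj
  have : IsReduced B := isReduced_of_injective (algebraMap B K) hBK
  have hfg' (i j) : map (algebraMap A B) (P i j) = f' i * g' j := by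
    apply map_injective _ hBK
    rw [map_map, map_mul, hf', hg', ← hfg]
    rfl
  have hsurj := algebraMap_surjective_of_factorization
    (fun x ↦ hA.mem_range_algebraMap hAB) hP h0 huv htr hfg'
    (fun i ↦ hBK (by rw [← constantCoeff_map, hf', hf]; rfl)) (by
      convert! Algebra.adjoin_adjoin_coe_preimage (R := A) (s := S)
      ext b
      refine exists₂_congr fun i d ↦ ?_
      rw [← hf', ← hg', coeff_map, coeff_map]
      exact or_congr hBK.eq_iff.symm hBK.eq_iff.symm)
  choose f'' hf'' using fun i ↦ map_surjective (σ := σ) _ hsurj (f' i)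
  choose g'' hg'' using fun i ↦ map_surjective (σ := σ) _ hsurj (g' i)
  exact ⟨f'', g'', fun i j ↦ map_injective _ hAB (by rw [hfg', map_mul, hf'', hg''])⟩

/-! ### Idempotent matrices of rank one -/

/-- The rank polynomial of `U W`, where `W U = 1`, is `T ^ r` with `r` the size of `W U`. -/
theorem Matrix.rankPolynomial_mul {R : Type*} [CommRing R] {n r : ℕ}
    (U : Matrix (Fin n) (Fin r) R) (W : Matrix (Fin r) (Fin n) R) (h : W * U = 1) :
    (U * W).rankPolynomial = Polynomial.X ^ r := by
  have hWU : W.map Polynomial.C * U.map Polynomial.C = 1 := by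
    rw [← Matrix.map_mul, h, Matrix.map_one _ (map_zero _) (map_one _)]
  have h1 : (Polynomial.X : Polynomial R) • (U * W).map Polynomial.C +
      (1 - (U * W).map Polynomial.C) =
      1 + U.map Polynomial.C * ((Polynomial.X - 1 : Polynomial R) • W.map Polynomial.C) := by
    rw [Matrix.map_mul, Matrix.mul_smul, sub_smul, one_smul]
    abel
  have h2 : (1 : Matrix (Fin r) (Fin r) (Polynomial R)) + (Polynomial.X - 1 : Polynomial R) • 1 =
      (Polynomial.X : Polynomial R) • 1 := by
    rw [sub_smul, one_smul]; abel
  rw [Matrix.rankPolynomial, h1, Matrix.det_one_add_mul_comm, Matrix.smul_mul, hWU, h2,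
    Matrix.det_smul, Matrix.det_one, mul_one, Fintype.card_fin]

/-- An idempotent matrix over a field is the product of matrices whose product in the reverse
order is an identity matrix. -/
theorem Matrix.exists_eq_mul_of_idempotent {F : Type*} [Field F] {n : ℕ}
    {P : Matrix (Fin n) (Fin n) F} (hP : P * P = P) :
    ∃ (r : ℕ) (U : Matrix (Fin n) (Fin r) F) (W : Matrix (Fin r) (Fin n) F),
      P = U * W ∧ W * U = 1 := by
  let φ := Matrix.toLin' P
  have hφ (x : LinearMap.range φ) : φ x = x := by
    obtain ⟨_, y, rfl⟩ := x
    change (Matrix.toLin' P * Matrix.toLin' P) y = _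
    rw [Module.End.mul_eq_comp, ← Matrix.toLin'_mul, hP]
  let b := Module.finBasis F (LinearMap.range φ)
  let ι := (LinearMap.range φ).subtype ∘ₗ b.equivFun.symm.toLinearMap
  let ρ := b.equivFun.toLinearMap ∘ₗ φ.rangeRestrict
  refine ⟨_, LinearMap.toMatrix' ι, LinearMap.toMatrix' ρ, ?_, ?_⟩
  · rw [← LinearMap.toMatrix'_comp, ← LinearMap.toMatrix'_toLin' P]
    congr 1
    refine LinearMap.ext fun x ↦ ?_
    simp [ι, ρ, φ]
  · rw [← LinearMap.toMatrix'_comp, ← LinearMap.toMatrix'_id]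
    congr 1
    refine LinearMap.ext fun x ↦ ?_
    change b.equivFun (φ.rangeRestrict (b.equivFun.symm x)) = x
    rw [← LinearEquiv.eq_symm_apply]
    exact Subtype.ext (hφ _)

theorem Matrix.IsIdempotentOfRank.exists_factorization_of_field {F : Type*} [Field F] {n : ℕ}
    {P : Matrix (Fin n) (Fin n) F} (hP : P.IsIdempotentOfRank 1) :
    ∃ u v : Fin n → F, (∀ i j, P i j = u i * v j) ∧ ∑ i, u i * v i = 1 := by
  obtain ⟨r, U, W, rfl, h⟩ := exists_eq_mul_of_idempotent hP.1
  obtain rfl : r = 1 := by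
    simpa using congr_arg Polynomial.natDegree ((rankPolynomial_mul U W h).symm.trans hP.2)
  refine ⟨fun i ↦ U i 0, fun j ↦ W 0 j, fun i j ↦ by simp [Matrix.mul_apply], ?_⟩
  simpa [Matrix.mul_apply, mul_comm] using congr_fun₂ h 0 0

theorem Matrix.IsIdempotentOfRank.map {R S : Type*} [CommRing R] [CommRing S] {n k : ℕ}
    {P : Matrix (Fin n) (Fin n) R} (hP : P.IsIdempotentOfRank k) (φ : R →+* S) :
    (P.map φ).IsIdempotentOfRank k := by
  refine ⟨by rw [← Matrix.map_mul, hP.1], ?_⟩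
  have := congr_arg (Polynomial.mapRingHom φ) hP.2
  rw [rankPolynomial, RingHom.map_det, map_pow, Polynomial.coe_mapRingHom, Polynomial.map_X] at this
  rw [← this, rankPolynomial]
  congr 1
  ext i j : 2
  by_cases hij : i = j <;> simp [hij]

/-- Since `R` is reduced, both identities can be tested in the residue fields, where `P` is a column
times a row. -/
theorem Matrix.IsIdempotentOfRank.minors_eq_zero_and_trace_eq_one {R : Type*} [CommRing R]
    [IsReduced R] {n : ℕ} {P : Matrix (Fin n) (Fin n) R} (hP : P.IsIdempotentOfRank 1) :
    (∀ i j k l, P i j * P k l = P i l * P k j) ∧ ∑ i, P i i = 1 := by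
  have hloc (p : PrimeSpectrum R) :=
    (hP.map (algebraMap R p.asIdeal.ResidueField)).exists_factorization_of_field
  choose u v hPuv huv using hloc
  have hPuv (p : PrimeSpectrum R) (i j) :
      algebraMap R p.asIdeal.ResidueField (P i j) = u p i * v p j := hPuv p i j
  refine ⟨fun i j k l ↦ ?_, ?_⟩
  · refine PrimeSpectrum.injective_algebraMap_residueField R (funext fun p ↦ ?_)
    change algebraMap R p.asIdeal.ResidueField _ = algebraMap R p.asIdeal.ResidueField _
    simp only [map_mul, hPuv]
    ring
  · refine PrimeSpectrum.injective_algebraMap_residueField R (funext fun p ↦ ?_)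
    change algebraMap R p.asIdeal.ResidueField _ = algebraMap R p.asIdeal.ResidueField _
    simp only [map_sum, map_one, hPuv, huv]

/-! ### Invertible modules and the Picard group -/

open scoped TensorProduct in
/-- An invertible module `N` that becomes free over `S` is the image of a matrix with vanishing
`2 × 2` minors and trace `1` that factors as a column times a row over `S`; if the matrix factors
so over `R`, then `N` is free. -/
theorem Module.Invertible.exists_matrix {R S N : Type*} [CommRing R] [CommRing S] [Algebra R S]
    [AddCommGroup N] [Module R N] [Module.Invertible R N] (e : S ⊗[R] N ≃ₗ[S] S) :
    ∃ (n : ℕ) (P : Fin n → Fin n → R) (u v : Fin n → S),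
      (∀ i j k l, P i j * P k l = P i l * P k j) ∧ ∑ i, P i i = 1 ∧
      (∀ i j, algebraMap R S (P i j) = u i * v j) ∧ ∑ i, v i * u i = 1 ∧
      ((∃ f g : Fin n → R, ∀ i j, P i j = f i * g j) → Nonempty (N ≃ₗ[R] R)) := by
  obtain ⟨n, π, ι, -, -, hπι⟩ := Module.Finite.exists_comp_eq_id_of_projective R N
  let x (j : Fin n) : N := π (Pi.single j 1)
  have hx (y : N) : ∑ j, ι y j • x j = y := by
    conv_rhs => rw [← LinearMap.id_apply (R := R) y, ← hπι, LinearMap.comp_apply,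
      pi_eq_sum_univ' (ι y), map_sum]
    simp [x]
  -- In the tensor square of an invertible module, `y ⊗ z = z ⊗ y`.
  have hswap (i y z) : ι y i • z = ι z i • y := by
    simpa using congr_arg (TensorProduct.lift ((LinearMap.lsmul R N).comp (LinearMap.proj i ∘ₗ ι)))
      (Module.Invertible.tmul_comm (R := R) (m₁ := y) (m₂ := z))
  have htr : ∑ i, ι (x i) i = 1 := by
    refine FaithfulSMul.eq_of_smul_eq_smul (α := N) fun y ↦ ?_
    rw [Finset.sum_smul, one_smul]
    conv_rhs => rw [← hx y]
    exact Finset.sum_congr rfl fun i _ ↦ hswap i _ _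
  let l (i : Fin n) : S ⊗[R] N →ₗ[S] S :=
    (TensorProduct.AlgebraTensorModule.rid R S S).toLinearMap ∘ₗ
      (LinearMap.proj i ∘ₗ ι).baseChange S
  have hl (i j) : algebraMap R S (ι (x j) i) = l i (e.symm 1) * e (1 ⊗ₜ x j) := by
    have h1 : l i (1 ⊗ₜ x j) = algebraMap R S (ι (x j) i) := by
      simp [l, Algebra.algebraMap_eq_smul_one]
    rw [← h1, mul_comm, ← smul_eq_mul, ← map_smul, ← map_smul, smul_eq_mul, mul_one,
      e.symm_apply_apply]
  refine ⟨n, fun i j ↦ ι (x j) i, fun i ↦ l i (e.symm 1), fun j ↦ e (1 ⊗ₜ x j),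
    fun i j k l ↦ ?_, htr, hl, ?_, ?_⟩
  · simpa [mul_comm] using congr_arg (fun y ↦ ι y k) (hswap i (x j) (x l))
  · simpa only [mul_comm, ← hl, ← map_sum, map_one] using congr_arg (algebraMap R S) htr
  · rintro ⟨f, g, h⟩
    -- The coordinates of `y` satisfy `ι y = P (ι y) = f (g · ι y)`, so `∑ f i • x i` generates `N`.
    have hsurj : Function.Surjective (LinearMap.toSpanSingleton R N (∑ i, f i • x i)) := by
      intro y
      refine ⟨∑ j, g j * ι y j, ?_⟩
      conv_rhs => rw [← hx y]
      rw [LinearMap.toSpanSingleton_apply, Finset.smul_sum]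
      refine Finset.sum_congr rfl fun i _ ↦ ?_
      rw [smul_smul]
      congr 1
      conv_rhs => rw [← hx y]
      simp only [map_sum, map_smul, Finset.sum_apply, Pi.smul_apply, smul_eq_mul, h,
        Finset.sum_mul]
      exact Finset.sum_congr rfl fun j _ ↦ by ring
    exact ⟨(LinearEquiv.ofBijective _
      (Module.Invertible.bijective_of_surjective hsurj)).symm⟩

open MvPolynomial in
/-- Over a seminormal ring, an invertible module over the polynomial ring is trivial as soon as
its restriction to the origin is trivial. -/
theorem IsSeminormalRing.pic_eq_one {A σ : Type*} [CommRing A] (hA : IsSeminormalRing A)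
    [Finite σ] {N : CommRing.Pic (MvPolynomial σ A)}
    (hN : CommRing.Pic.mapRingHom (constantCoeff : MvPolynomial σ A →+* A) N = 1) : N = 1 := by
  -- Here `A` is an algebra over `A[X]` through evaluation at the origin.
  algebraize [(constantCoeff : MvPolynomial σ A →+* A)]
  obtain ⟨e⟩ := CommRing.Pic.mk_eq_one_iff.mp hN
  obtain ⟨n, P, u, v, hP, htr, h0, huv, hfree⟩ := Module.Invertible.exists_matrix e
  obtain ⟨e'⟩ := hfree (hA.exists_factorization hP h0 huv htr)
  rw [← CommRing.Pic.mk_eq_self (M := N)]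
  exact CommRing.Pic.mk_eq_one_iff.mpr ⟨e'⟩

open MvPolynomial in
/-- If `A` is seminormal, the natural map `Pic A → Pic A[X₁, …, X_m]` is an isomorphism, and every
idempotent matrix `P` of rank `1` over `A[X₁, …, X_m]` with `P(0) = I_{n,1}` is the product of a
column and a row with entries in `A[X₁, …, X_m]`. -/
theorem theoremD1 (A : Type*) [CommRing A] (hA : IsSeminormalRing A) (m : ℕ) :
    Function.Bijective (CommRing.Pic.mapAlgebra A (MvPolynomial (Fin m) A)) ∧
      ∀ (n : ℕ) (P : Matrix (Fin n) (Fin n) (MvPolynomial (Fin m) A)),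
        P.IsIdempotentOfRank 1 →
        P.map (MvPolynomial.eval (0 : Fin m → A)) = Matrix.standardProjection A n 1 →
        ∃ f g : Fin n → MvPolynomial (Fin m) A, ∀ i j, P i j = f i * g j := by
  have hret (M : CommRing.Pic A) :
      CommRing.Pic.mapRingHom (constantCoeff : MvPolynomial (Fin m) A →+* A)
        (CommRing.Pic.mapAlgebra A (MvPolynomial (Fin m) A) M) = M := by
    rw [← CommRing.Pic.mapRingHom_algebraMap, CommRing.Pic.mapRingHom_mapRingHom,
      show constantCoeff.comp (algebraMap A (MvPolynomial (Fin m) A)) = RingHom.id A from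
        RingHom.ext (constantCoeff_C _), CommRing.Pic.mapRingHom_id_apply]
  refine ⟨⟨Function.LeftInverse.injective hret, fun M ↦ ?_⟩, fun n P hP h0 ↦ ?_⟩
  -- The quotient of `M` by the extension of its restriction to the origin is trivial at the origin.
  · refine ⟨CommRing.Pic.mapRingHom constantCoeff M, (mul_inv_eq_one.mp ?_).symm⟩
    apply hA.pic_eq_one
    rw [map_mul, map_inv, hret, mul_inv_cancel]
  · have := hA.isReduced
    obtain ⟨hminor, htr⟩ := hP.minors_eq_zero_and_trace_eq_one
    cases n with
    | zero => exact ⟨0, 0, fun i ↦ i.elim0⟩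
    | succ n =>
      have hval (i : Fin (n + 1)) : (i : ℕ) < 1 ↔ i = 0 := by
        rw [Nat.lt_one_iff, Fin.val_eq_zero_iff]
      refine hA.exists_factorization (u := Pi.single 0 1) (v := Pi.single 0 1) hminor
        (fun i j ↦ ?_) ?_ htr
      swap
      · simp [Pi.single_apply]
      rw [← eval_zero]
      refine (congr_fun₂ h0 i j).trans ?_
      simp only [Matrix.standardProjection, Matrix.diagonal_apply, hval, Pi.single_apply]
      grind
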